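/- Let $\Gamma=\{0,\tilde\imath,\tilde\jmath,\tilde k\}\le(\mathbb Z_2)^3$ with $\tilde\imath=(0,1,1)$, $\tilde\jmath=(1,0,1)$, $\tilde k=(1,1,0)$, and let $\lambda(x,y)=(-1)^{\langle x,y\rangle}$ for $x,y\in\Gamma$. The real quaternion algebra $\mathbb H=\mathbb R\oplus i\mathbb R\oplus j\mathbb R\oplus k\mathbb R$ is $\Gamma$-graded by $\mathbb H^{0}=\mathbb R$, $\mathbb H^{\tilde\imath}=i\mathbb R$, $\mathbb H^{\tilde\jmath}=j\mathbb R$, $\mathbb H^{\tilde k}=k\mathbb R$, and $ab=\lambda(\tilde a,\tilde b)\,ba$ for homogeneous $a,b$ of degrees $\tilde a,\tilde b$. An NS-multiplier is a biadditive map $\varsigma:\Gamma\times\Gamma\to\mathbb R^\times$ with $\lambda(x,y)\,\varsigma(x,y)\,\varsigma(y,x)^{-1}=1$ for all $x,y\in\Gamma$ (every $x\in\Gamma$ is even, i.e. $\lambda(x,x)=1$). The product $a\star b=\varsigma(\tilde a,\tilde b)\,ab$ (for homogeneous $a,b$, extended biadditively) makes the vector space $\mathbb H$ into a commutative algebra $\underline{\mathbb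 H}$. Let $n\in\mathbb N$ and $\nu\in\Gamma^n$. A matrix $X\in M_n(\mathbb H)$ is homogeneous of degree $x\in\Gamma$ if $X_{ij}\in\mathbb H^{x-\nu_i+\nu_j}$ for all $i,j$. Let $J_\varsigma: M_n(\mathbb H)\to M_n(\underline{\mathbb H})$ be the additive map with $J_\varsigma(X)_{ij}=\varsigma(x,\nu_j)\,\varsigma(\nu_i,x-\nu_i+\nu_j)^{-1}X_{ij}$ for $X$ homogeneous of degree $x$, and put $\mathrm{Gdet}_\varsigma(X)=\det_{\underline{\mathbb H}}(J_\varsigma(X))$. Let $\mathrm{hGL}(\nu;\mathbb H)\le \mathrm{GL}(n;\mathbb H)$ be the group of invertible matrices that are homogeneous of some degree, let $\mathbb H_h^\times=\mathbb R^\times\cup i\mathbb R^\times\cup j\mathbb R^\times\cup k\mathbb R^\times$ be the group of homogeneous invertible quaternions, and let $\pi:\mathbb H_h^\times\to\mathbb H_h^\times/\{\pm1,\pm i,\pm j,\pm k\}\cong\mathbb R^\times/\{\pm1\}$ be the quotient map, the isomorphism being the one induced by the inclusion $\mathbb R^\times\subset\mathbb H_h^\times$. There is a unique group morphism $\mathrm{Ddet}:\mathrm{GL}(n;\mathbb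 H)\to\mathbb R^\times/\{\pm1\}$ (the Dieudonné determinant) such that $\mathrm{Ddet}(\mathrm{diag}(1,\dots,1,a))=a\cdot\{\pm1\}$ for all $a\in\mathbb R^\times$ (a condition that is void for $n=0$). Moreover, for every NS-multiplier $\varsigma$ and every $\nu\in\Gamma^n$, $\mathrm{Gdet}_\varsigma$ restricts to a group morphism $\mathrm{hGL}(\nu;\mathbb H)\to\mathbb H_h^\times$, and $$\pi\circ\mathrm{Gdet}_\varsigma=\mathrm{Ddet}|_{\mathrm{hGL}(\nu;\mathbb H)}.$$ -/

import Mathlib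

namespace GradedDet

/-! ### Commutation factors, NS-multipliers and the twisted algebra -/

section Multipliers

variable {Γ K : Type*} [AddCommGroup Γ] [Field K]

open Classical in
/-- The parity of a degree: even (`0`) if `lam x x = 1`, odd (`1`) otherwise. -/
noncomputable def parity (lam : Γ → Γ → Kˣ) (x : Γ) : ZMod 2 :=
  if lam x x = 1 then 0 else 1

/-- The commutation factor of supercommutative algebras, `(-1)^(ab)`. -/
def superFactor (K : Type*) [Field K] (a b : ZMod 2) : Kˣ := (-1) ^ (a * b).val

/-- NS-multipliers for the commutation factor `lam`: biadditive maps `ς : Γ × Γ → Kˣ` for which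
the twisted factor `lam(x,y) ς(x,y) ς(y,x)⁻¹` is the super factor of the parities. -/
structure NSMultiplier (lam : Γ → Γ → Kˣ) where
  toFun : Γ → Γ → Kˣ
  map_add_left : ∀ x y z, toFun (x + y) z = toFun x z * toFun y z
  map_add_right : ∀ x y z, toFun x (y + z) = toFun x y * toFun x z
  twist : ∀ x y, lam x y * toFun x y * (toFun y x)⁻¹ = superFactor K (parity lam x) (parity lam y)

/-- There are no odd degrees. -/
class PurelyEven (lam : Γ → Γ → Kˣ) : Prop where
  self_eq_one : ∀ x, lam x x = 1

/-- A `Γ`-graded algebra is `(Γ, lam)`-commutative if `a b = lam(deg a, deg b) b a` for all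
homogeneous `a`, `b`. -/
class ColorCommutative {A : Type*} [Ring A] [Algebra K A] (lam : Γ → Γ → Kˣ)
    (𝒜 : Γ → Submodule K A) : Prop where
  comm : ∀ x y : Γ, ∀ a ∈ 𝒜 x, ∀ b ∈ 𝒜 y, a * b = (lam x y : K) • (b * a)

variable {lam : Γ → Γ → Kˣ}

theorem NSMultiplier.zero_left (s : NSMultiplier lam) (x : Γ) : s.toFun 0 x = 1 := by
  have h := s.map_add_left 0 0 x
  simpa using h

theorem NSMultiplier.zero_right (s : NSMultiplier lam) (x : Γ) : s.toFun x 0 = 1 := by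
  have h := s.map_add_right x 0 0
  simpa using h

theorem NSMultiplier.comm [he : PurelyEven lam] (s : NSMultiplier lam) (x y : Γ) :
    (s.toFun x y : K) * lam x y = s.toFun y x := by
  have h := s.twist x y
  have hp : ∀ z, parity lam z = 0 := fun z => by simp [parity, he.self_eq_one z]
  simp only [hp, superFactor, mul_zero, ZMod.val_zero, pow_zero] at h
  rw [mul_inv_eq_one] at h
  rw [mul_comm, ← h]; simp

end Multipliers

section Projections

variable {Γ K A : Type*} [AddCommGroup Γ] [DecidableEq Γ] [Field K] [Ring A]
  [Algebra K A] (𝒜 : Γ → Submodule K A) [GradedAlgebra 𝒜]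

theorem proj_of_mem {x : Γ} {a : A} (ha : a ∈ 𝒜 x) (y : Γ) :
    GradedAlgebra.proj 𝒜 y a = if y = x then a else 0 := by
  rw [GradedAlgebra.proj_apply]
  split_ifs with h
  · subst h; exact DirectSum.decompose_of_mem_same 𝒜 ha
  · exact DirectSum.decompose_of_mem_ne 𝒜 ha (Ne.symm h)

theorem proj_mul_of_left_mem {x : Γ} {a : A} (ha : a ∈ 𝒜 x) (b : A) (y : Γ) :
    GradedAlgebra.proj 𝒜 (x + y) (a * b) = a * GradedAlgebra.proj 𝒜 y b := by
  simp only [GradedAlgebra.proj_apply]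
  exact DirectSum.coe_decompose_mul_add_of_left_mem 𝒜 ha

end Projections

section Twisted

variable {Γ K A : Type*} [AddCommGroup Γ] [DecidableEq Γ] [Fintype Γ] [Field K] [Ring A]
  [Algebra K A] {lam : Γ → Γ → Kˣ} (𝒜 : Γ → Submodule K A) [GradedAlgebra 𝒜]

/-- The underlying vector space of the algebra obtained by twisting the product of `A`. -/
def Twisted (_𝒜 : Γ → Submodule K A) (_s : NSMultiplier lam) : Type _ := A

variable (s : NSMultiplier lam)

instance : AddCommGroup (Twisted 𝒜 s) := inferInstanceAs (AddCommGroup A)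

instance : Module K (Twisted 𝒜 s) := inferInstanceAs (Module K A)

/-- The identity map from `A` to its twisted version. -/
def toTwisted : A ≃ₗ[K] Twisted 𝒜 s := LinearEquiv.refl K A

/-- The twisted product `a ⋆ b = ς(deg a, deg b) a b`, extended biadditively from homogeneous
elements to all elements. -/
noncomputable def twistMul (a b : A) : A :=
  ∑ x : Γ, ∑ y : Γ, (s.toFun x y : K) • (GradedAlgebra.proj 𝒜 x a * GradedAlgebra.proj 𝒜 y b)

theorem twistMul_of_mem {x y : Γ} {a b : A} (ha : a ∈ 𝒜 x) (hb : b ∈ 𝒜 y) :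
    twistMul 𝒜 s a b = (s.toFun x y : K) • (a * b) := by
  simp [twistMul, proj_of_mem 𝒜 ha, proj_of_mem 𝒜 hb]

theorem twistMul_add_left (a a' b : A) : twistMul 𝒜 s (a + a') b = twistMul 𝒜 s a b + twistMul 𝒜 s a' b := by
  simp [twistMul, add_mul, Finset.sum_add_distrib, -GradedAlgebra.proj_apply]

theorem twistMul_add_right (a b b' : A) : twistMul 𝒜 s a (b + b') = twistMul 𝒜 s a b + twistMul 𝒜 s a b' := by
  simp [twistMul, mul_add, Finset.sum_add_distrib, -GradedAlgebra.proj_apply]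

theorem twistMul_zero_left (b : A) : twistMul 𝒜 s 0 b = 0 := by simp [twistMul]

theorem twistMul_zero_right (a : A) : twistMul 𝒜 s a 0 = 0 := by simp [twistMul]

theorem twistMul_one_left (b : A) : twistMul 𝒜 s 1 b = b := by
  induction b using DirectSum.Decomposition.inductionOn 𝒜 with
  | zero => exact twistMul_zero_right 𝒜 s 1
  | homogeneous b =>
    rw [twistMul_of_mem 𝒜 s (SetLike.GradedOne.one_mem) b.2, s.zero_left]; simp
  | add b b' hb hb' => rw [twistMul_add_right, hb, hb']

theorem twistMul_one_right (a : A) : twistMul 𝒜 s a 1 = a := by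
  induction a using DirectSum.Decomposition.inductionOn 𝒜 with
  | zero => exact twistMul_zero_left 𝒜 s 1
  | homogeneous a =>
    rw [twistMul_of_mem 𝒜 s a.2 (SetLike.GradedOne.one_mem), s.zero_right]; simp
  | add a a' ha ha' => rw [twistMul_add_left, ha, ha']

theorem twistMul_assoc (a b c : A) : twistMul 𝒜 s (twistMul 𝒜 s a b) c = twistMul 𝒜 s a (twistMul 𝒜 s b c) := by
  induction a using DirectSum.Decomposition.inductionOn 𝒜 with
  | zero => simp [twistMul_zero_left]
  | add a a' ha ha' => simp only [twistMul_add_left, ha, ha']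
  | @homogeneous x a =>
  induction b using DirectSum.Decomposition.inductionOn 𝒜 with
  | zero => simp [twistMul_zero_left, twistMul_zero_right]
  | add b b' hb hb' => simp only [twistMul_add_left, twistMul_add_right, hb, hb']
  | @homogeneous y b =>
  induction c using DirectSum.Decomposition.inductionOn 𝒜 with
  | zero => simp [twistMul_zero_right]
  | add c c' hc hc' => simp only [twistMul_add_right, hc, hc']
  | @homogeneous z c =>
  rw [twistMul_of_mem 𝒜 s a.2 b.2, twistMul_of_mem 𝒜 s b.2 c.2,
    twistMul_of_mem 𝒜 s ((𝒜 (x + y)).smul_mem _ (SetLike.GradedMul.mul_mem a.2 b.2)) c.2,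
    twistMul_of_mem 𝒜 s a.2 ((𝒜 (y + z)).smul_mem _ (SetLike.GradedMul.mul_mem b.2 c.2)),
    s.map_add_left, s.map_add_right]
  simp only [smul_mul_assoc, mul_smul_comm, smul_smul, mul_assoc, Units.val_mul]
  congr 1
  ring

theorem twistMul_comm [PurelyEven lam] [hc : ColorCommutative lam 𝒜] (a b : A) :
    twistMul 𝒜 s a b = twistMul 𝒜 s b a := by
  induction a using DirectSum.Decomposition.inductionOn 𝒜 with
  | zero => simp [twistMul_zero_left, twistMul_zero_right]
  | add a a' ha ha' => simp only [twistMul_add_left, twistMul_add_right, ha, ha']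
  | @homogeneous x a =>
  induction b using DirectSum.Decomposition.inductionOn 𝒜 with
  | zero => simp [twistMul_zero_left, twistMul_zero_right]
  | add b b' hb hb' => simp only [twistMul_add_left, twistMul_add_right, hb, hb']
  | @homogeneous y b =>
  rw [twistMul_of_mem 𝒜 s a.2 b.2, twistMul_of_mem 𝒜 s b.2 a.2, hc.comm x y a a.2 b b.2, smul_smul,
    s.comm]

/-- In the purely even case the twisted algebra is a commutative ring for the product `⋆`. -/
noncomputable instance [PurelyEven lam] [ColorCommutative lam 𝒜] : CommRing (Twisted 𝒜 s) where
  __ := (inferInstance : AddCommGroup (Twisted 𝒜 s))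
  mul a b := toTwisted 𝒜 s (twistMul 𝒜 s ((toTwisted 𝒜 s).symm a) ((toTwisted 𝒜 s).symm b))
  one := toTwisted 𝒜 s 1
  left_distrib a b c := twistMul_add_right 𝒜 s a b c
  right_distrib a b c := twistMul_add_left 𝒜 s a b c
  zero_mul a := twistMul_zero_left 𝒜 s a
  mul_zero a := twistMul_zero_right 𝒜 s a
  mul_assoc a b c := twistMul_assoc 𝒜 s a b c
  one_mul a := twistMul_one_left 𝒜 s a
  mul_one a := twistMul_one_right 𝒜 s a
  mul_comm a b := twistMul_comm 𝒜 s a b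

/-! ### Graded matrices and the graded determinant -/

variable {n : ℕ} (ν : Fin n → Γ)

/-- `X` is homogeneous of degree `x` for the grading of matrices defined by `ν`. -/
def IsHomogeneousMatrix (x : Γ) (X : Matrix (Fin n) (Fin n) A) : Prop :=
  ∀ i j, X i j ∈ 𝒜 (x - ν i + ν j)

/-- The map `J_ς`. On a homogeneous matrix of degree `x` it multiplies the entry `(i, j)` by
`ς(x, ν j) ς(ν i, x - ν i + ν j)⁻¹`; on a general matrix, it is the sum over all degrees `x` of
its values on the component of degree `x`. -/
noncomputable def J (X : Matrix (Fin n) (Fin n) A) : Matrix (Fin n) (Fin n) (Twisted 𝒜 s) :=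
  Matrix.of fun i j => ∑ x : Γ,
    ((s.toFun x (ν j) * (s.toFun (ν i) (x - ν i + ν j))⁻¹ : Kˣ) : K) •
      toTwisted 𝒜 s (GradedAlgebra.proj 𝒜 (x - ν i + ν j) (X i j))

/-- `Gdet_ς = det ∘ J_ς`, the determinant being that of matrices over the twisted algebra. -/
noncomputable def Gdet [PurelyEven lam] [ColorCommutative lam 𝒜]
    (X : Matrix (Fin n) (Fin n) A) : A :=
  (toTwisted 𝒜 s).symm (J 𝒜 s ν X).det

theorem J_of_isHomogeneousMatrix {x : Γ} {X : Matrix (Fin n) (Fin n) A}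
    (hX : IsHomogeneousMatrix 𝒜 ν x X) (i j : Fin n) :
    J 𝒜 s ν X i j = ((s.toFun x (ν j) * (s.toFun (ν i) (x - ν i + ν j))⁻¹ : Kˣ) : K) •
      toTwisted 𝒜 s (X i j) := by
  simp only [J, Matrix.of_apply]
  rw [Finset.sum_eq_single x]
  · rw [proj_of_mem 𝒜 (hX i j), if_pos rfl]
  · intro y _ hy
    rw [proj_of_mem 𝒜 (hX i j), if_neg (by simpa using hy)]
    simp
  · simp

end Twisted

/-! ### The groups of homogeneous units and of homogeneous invertible matrices -/

section HomogeneousGroups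

variable {Γ K A : Type*} [AddCommGroup Γ] [DecidableEq Γ] [Field K] [Ring A]
  [Algebra K A] (𝒜 : Γ → Submodule K A) [GradedAlgebra 𝒜]

variable {n : ℕ} (ν : Fin n → Γ)

/-- The group of homogeneous invertible matrices of `GL(n, A)`, of any degree. -/
def homGL : Subgroup (GL (Fin n) A) where
  carrier := {X | ∃ x : Γ, IsHomogeneousMatrix 𝒜 ν x X.val}
  one_mem' := by
    refine ⟨0, fun i j => ?_⟩
    rcases eq_or_ne i j with rfl | h
    · simpa using (SetLike.GradedOne.one_mem : (1 : A) ∈ 𝒜 0)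
    · simp [Matrix.one_apply_ne h]
  mul_mem' := by
    rintro X Y ⟨x, hX⟩ ⟨y, hY⟩
    refine ⟨x + y, fun i j => ?_⟩
    rw [Units.val_mul, Matrix.mul_apply]
    refine Submodule.sum_mem _ fun k _ => ?_
    have h := SetLike.GradedMul.mul_mem (hX i k) (hY k j)
    rwa [show x - ν i + ν k + (y - ν k + ν j) = x + y - ν i + ν j by abel] at h
  inv_mem' := by
    rintro X ⟨x, hX⟩
    refine ⟨-x, ?_⟩
    let Z : Matrix (Fin n) (Fin n) A :=
      Matrix.of fun i j => GradedAlgebra.proj 𝒜 (-x - ν i + ν j) ((X⁻¹).val i j)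
    have hZ : X.val * Z = 1 := by
      ext i j
      have h1 : ∀ k, X.val i k * Z k j =
          GradedAlgebra.proj 𝒜 (-ν i + ν j) (X.val i k * (X⁻¹).val k j) := fun k => by
        rw [show -ν i + ν j = (x - ν i + ν k) + (-x - ν k + ν j) by abel,
          proj_mul_of_left_mem 𝒜 (hX i k)]
        rfl
      rw [Matrix.mul_apply, Finset.sum_congr rfl fun k _ => h1 k, ← map_sum, ← Matrix.mul_apply,
        Units.mul_inv]
      rcases eq_or_ne i j with rfl | h
      · rw [Matrix.one_apply_eq, proj_of_mem 𝒜 SetLike.GradedOne.one_mem, if_pos (by simp)]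
      · rw [Matrix.one_apply_ne h, map_zero]
    have hZ' : (X⁻¹).val = Z := by
      calc (X⁻¹).val = (X⁻¹).val * (X.val * Z) := by rw [hZ, mul_one]
        _ = Z := by rw [← mul_assoc, Units.inv_mul, one_mul]
    intro i j
    rw [hZ']
    simp [Z]

/-- The group of homogeneous invertible elements of `A`, of any degree. -/
def homUnits : Subgroup Aˣ where
  carrier := {u | ∃ x : Γ, (u : A) ∈ 𝒜 x}
  one_mem' := ⟨0, SetLike.GradedOne.one_mem⟩
  mul_mem' := by
    rintro u v ⟨x, hu⟩ ⟨y, hv⟩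
    exact ⟨x + y, SetLike.GradedMul.mul_mem hu hv⟩
  inv_mem' := by
    rintro u ⟨x, hu⟩
    refine ⟨-x, ?_⟩
    have h : (u : A) * GradedAlgebra.proj 𝒜 (-x) (u⁻¹ : Aˣ) = 1 := by
      rw [← proj_mul_of_left_mem 𝒜 hu, Units.mul_inv, proj_of_mem 𝒜 SetLike.GradedOne.one_mem,
        if_pos (by simp)]
    have h' : ((u⁻¹ : Aˣ) : A) = GradedAlgebra.proj 𝒜 (-x) (u⁻¹ : Aˣ) := by
      rw [Units.inv_eq_of_mul_eq_one_right h]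
      simp
    rw [h']
    simp

end HomogeneousGroups

/-! ### The quaternion algebra as a graded commutative algebra -/

/-- The quaternion `a + b i + c j + d k`. -/
def quat (a b c d : ℝ) : Quaternion ℝ := ⟨a, b, c, d⟩

@[simp] theorem re_quat (a b c d : ℝ) : (quat a b c d).re = a := rfl
@[simp] theorem imI_quat (a b c d : ℝ) : (quat a b c d).imI = b := rfl
@[simp] theorem imJ_quat (a b c d : ℝ) : (quat a b c d).imJ = c := rfl
@[simp] theorem imK_quat (a b c d : ℝ) : (quat a b c d).imK = d := rfl

/-- The quaternions `i`, `j`, `k` have degrees `(0,1,1)`, `(1,0,1)`, `(1,1,0)`. -/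
def degI : Fin 3 → ZMod 2 := ![0, 1, 1]
/-- The degree of the quaternion `j`. -/
def degJ : Fin 3 → ZMod 2 := ![1, 0, 1]
/-- The degree of the quaternion `k`. -/
def degK : Fin 3 → ZMod 2 := ![1, 1, 0]

/-- The grading group of the quaternions, a subgroup of `(ℤ/2)³`. -/
def QuatDeg : AddSubgroup (Fin 3 → ZMod 2) where
  carrier := {x | x = 0 ∨ x = degI ∨ x = degJ ∨ x = degK}
  zero_mem' := Or.inl rfl
  add_mem' := by
    rintro _ _ (rfl | rfl | rfl | rfl) (rfl | rfl | rfl | rfl) <;>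
      simp only [Set.mem_ofPred_eq] <;> decide
  neg_mem' := by
    rintro _ (rfl | rfl | rfl | rfl) <;> simp only [Set.mem_ofPred_eq] <;> decide

instance : DecidablePred (· ∈ QuatDeg) := fun x =>
  inferInstanceAs (Decidable (x = 0 ∨ x = degI ∨ x = degJ ∨ x = degK))

/-- The commutation factor `(-1)^⟨x,y⟩`. -/
def quatLam (x y : QuatDeg) : ℝˣ := (-1) ^ (∑ i, x.1 i * y.1 i).val

theorem coe_quatLam (x y : QuatDeg) :
    (quatLam x y : ℝ) = if ∑ i, x.1 i * y.1 i = 0 then 1 else -1 := by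
  have h : ∀ z : ZMod 2, (((-1 : ℝˣ) ^ z.val : ℝˣ) : ℝ) = if z = 0 then 1 else -1 := by
    intro z
    have hz : ∀ z : ZMod 2, z = 0 ∨ z = 1 := by decide
    rcases hz z with rfl | rfl
    · simp
    · rw [if_neg (by decide), ZMod.val_one]; simp
  exact h _

instance : PurelyEven quatLam where
  self_eq_one := by
    rintro ⟨x, hx⟩
    have h : ∑ i, x i * x i = 0 := by
      rcases hx with rfl | rfl | rfl | rfl <;> decide
    simp [quatLam, h]

open scoped Quaternion in
/-- The grading of the quaternions: `ℝ` in degree `0`, and `iℝ`, `jℝ`, `kℝ` in the degrees of `i`,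
`j`, `k`. -/
def quatGrading (x : QuatDeg) : Submodule ℝ (Quaternion ℝ) where
  carrier := {q | (x.1 ≠ 0 → q.re = 0) ∧ (x.1 ≠ degI → q.imI = 0) ∧ (x.1 ≠ degJ → q.imJ = 0) ∧
    (x.1 ≠ degK → q.imK = 0)}
  zero_mem' := by simp
  add_mem' := by
    rintro a b ⟨h1, h2, h3, h4⟩ ⟨h1', h2', h3', h4'⟩
    exact ⟨fun h => by simp [h1 h, h1' h], fun h => by simp [h2 h, h2' h],
      fun h => by simp [h3 h, h3' h], fun h => by simp [h4 h, h4' h]⟩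
  smul_mem' := by
    rintro c a ⟨h1, h2, h3, h4⟩
    exact ⟨fun h => by simp [h1 h], fun h => by simp [h2 h], fun h => by simp [h3 h],
      fun h => by simp [h4 h]⟩

/-- The component of degree `x` of a quaternion. -/
def quatComponent (x : QuatDeg) (q : Quaternion ℝ) : Quaternion ℝ :=
  quat (if x.1 = 0 then q.re else 0) (if x.1 = degI then q.imI else 0)
    (if x.1 = degJ then q.imJ else 0) (if x.1 = degK then q.imK else 0)

theorem quatComponent_mem (x : QuatDeg) (q : Quaternion ℝ) :
    quatComponent x q ∈ quatGrading x :=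
  ⟨fun h => if_neg h, fun h => if_neg h, fun h => if_neg h, fun h => if_neg h⟩

theorem quatComponent_add (x : QuatDeg) (q r : Quaternion ℝ) :
    quatComponent x (q + r) = quatComponent x q + quatComponent x r := by
  ext <;> simp only [quatComponent, re_quat, imI_quat, imJ_quat, imK_quat, Quaternion.re_add,
    Quaternion.imI_add, Quaternion.imJ_add, Quaternion.imK_add] <;> split_ifs <;> simp

theorem sum_quatDeg {M : Type*} [AddCommMonoid M] (f : QuatDeg → M) :
    ∑ x, f x = f ⟨0, Or.inl rfl⟩ + f ⟨degI, Or.inr (Or.inl rfl)⟩ +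
      f ⟨degJ, Or.inr (Or.inr (Or.inl rfl))⟩ + f ⟨degK, Or.inr (Or.inr (Or.inr rfl))⟩ := by
  have h : (Finset.univ : Finset QuatDeg) = {⟨0, Or.inl rfl⟩, ⟨degI, Or.inr (Or.inl rfl)⟩,
      ⟨degJ, Or.inr (Or.inr (Or.inl rfl))⟩, ⟨degK, Or.inr (Or.inr (Or.inr rfl))⟩} := by decide
  rw [h, Finset.sum_insert (by decide), Finset.sum_insert (by decide),
    Finset.sum_insert (by decide), Finset.sum_singleton]
  simp only [add_assoc]

theorem sum_quatComponent (q : Quaternion ℝ) : ∑ x, quatComponent x q = q := by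
  rw [sum_quatDeg]
  ext <;> simp [quatComponent, degI, degJ, degK, funext_iff, Fin.forall_fin_succ]

open scoped Quaternion in
theorem quatComponent_of_mem {x y : QuatDeg} {q : Quaternion ℝ} (hq : q ∈ quatGrading x) :
    quatComponent y q = if y = x then q else 0 := by
  obtain ⟨h1, h2, h3, h4⟩ := hq
  split_ifs with h
  · subst h
    ext <;> simp only [quatComponent, re_quat, imI_quat, imJ_quat, imK_quat] <;>
      split_ifs with h' <;> first | rfl | symm
    · exact h1 h'
    · exact h2 h'
    · exact h3 h'
    · exact h4 h'
  · have key : ∀ {c : Fin 3 → ZMod 2} {r : ℝ}, (x.1 ≠ c → r = 0) →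
        (if y.1 = c then r else 0) = 0 := by
      intro c r hr
      split_ifs with h'
      · exact hr fun h'' => h (Subtype.ext (h'.trans h''.symm))
      · rfl
    ext
    · exact key h1
    · exact key h2
    · exact key h3
    · exact key h4

open scoped Quaternion in
noncomputable instance : GradedAlgebra quatGrading where
  one_mem := by
    refine ⟨fun h => absurd rfl h, fun _ => ?_, fun _ => ?_, fun _ => ?_⟩ <;> simp
  mul_mem := by
    rintro ⟨x, hx⟩ ⟨y, hy⟩ a b ⟨h1, h2, h3, h4⟩ ⟨h1', h2', h3', h4'⟩
    simp only at h1 h2 h3 h4 h1' h2' h3' h4'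
    rcases hx with rfl | rfl | rfl | rfl <;> rcases hy with rfl | rfl | rfl | rfl <;>
      simp (decide := true) at h1 h2 h3 h4 h1' h2' h3' h4' <;>
      refine ⟨?_, ?_, ?_, ?_⟩ <;> intro h <;>
      first
        | exact absurd (by decide) h
        | simp [*]
  decompose' q := ∑ x, DirectSum.of (fun x => quatGrading x) x
    ⟨quatComponent x q, quatComponent_mem x q⟩
  left_inv q := by
    simp only [map_sum, DirectSum.coeAddMonoidHom_of]
    exact sum_quatComponent q
  right_inv d := by
    induction d using DirectSum.induction_on with
    | zero =>
      refine Finset.sum_eq_zero fun x _ => ?_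
      convert map_zero (DirectSum.of (fun x => quatGrading x) x)
      rw [quatComponent_of_mem (x := x) (by simp)]
      simp
    | of x q =>
      simp only [DirectSum.coeAddMonoidHom_of]
      rw [Finset.sum_eq_single x]
      · congr 1
        ext1
        simp [quatComponent_of_mem q.2]
      · intro y _ hy
        convert map_zero (DirectSum.of (fun x => quatGrading x) y)
        simp [quatComponent_of_mem q.2, hy]
      · simp
    | add d d' hd hd' =>
      conv_rhs => rw [← hd, ← hd']
      rw [← Finset.sum_add_distrib]
      refine Finset.sum_congr rfl fun x _ => ?_
      rw [← map_add]
      congr 1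
      ext1
      simp only [map_add, Submodule.coe_add, quatComponent_add]

open scoped Quaternion in
instance : ColorCommutative quatLam quatGrading where
  comm := by
    rintro ⟨x, hx⟩ ⟨y, hy⟩ a ⟨h1, h2, h3, h4⟩ b ⟨h1', h2', h3', h4'⟩
    simp only at h1 h2 h3 h4 h1' h2' h3' h4'
    rw [coe_quatLam]
    rcases hx with rfl | rfl | rfl | rfl <;> rcases hy with rfl | rfl | rfl | rfl <;>
      simp (decide := true) at h1 h2 h3 h4 h1' h2' h3' h4' <;>
      simp (decide := true) only [if_true, if_false, one_smul, neg_smul] <;>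
      ext <;> simp [*, mul_comm]

/-! ### The quotient map and the Dieudonné determinant -/

/-- The subgroup `{±1}` of the group of nonzero real numbers. -/
def signs : Subgroup ℝˣ where
  carrier := {u | u = 1 ∨ u = -1}
  one_mem' := Or.inl rfl
  mul_mem' := by
    rintro _ _ (rfl | rfl) (rfl | rfl) <;> simp
  inv_mem' := by
    rintro _ (rfl | rfl) <;> simp

/-- The group of homogeneous invertible quaternions `ℝˣ ∪ iℝˣ ∪ jℝˣ ∪ kℝˣ`. -/
abbrev HomQuat : Type := homUnits quatGrading

/-- The quaternions `±1, ±i, ±j, ±k`. -/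
def basicQuats : Set (Quaternion ℝ) :=
  {q | ∃ e : ℝ, (e = 1 ∨ e = -1) ∧
    (q = quat e 0 0 0 ∨ q = quat 0 e 0 0 ∨ q = quat 0 0 e 0 ∨ q = quat 0 0 0 e)}

open scoped Quaternion in
theorem one_mem_basicQuats : 1 ∈ basicQuats :=
  ⟨1, Or.inl rfl, Or.inl (by ext <;> simp)⟩

theorem mul_mem_basicQuats {a b : Quaternion ℝ} (ha : a ∈ basicQuats) (hb : b ∈ basicQuats) :
    a * b ∈ basicQuats := by
  obtain ⟨e, he, ha⟩ := ha
  obtain ⟨f, hf, hb⟩ := hb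
  have h1 : e * f = 1 ∨ e * f = -1 := by
    rcases he with rfl | rfl <;> rcases hf with rfl | rfl <;> simp
  have h2 : -(e * f) = 1 ∨ -(e * f) = -1 := by
    rcases h1 with h | h <;> simp [h]
  rcases ha with rfl | rfl | rfl | rfl <;> rcases hb with rfl | rfl | rfl | rfl <;>
    first
      | (refine ⟨e * f, h1, Or.inl ?_⟩; (ext <;> simp); done)
      | (refine ⟨e * f, h1, Or.inr (Or.inl ?_)⟩; (ext <;> simp); done)
      | (refine ⟨e * f, h1, Or.inr (Or.inr (Or.inl ?_))⟩; (ext <;> simp); done)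
      | (refine ⟨e * f, h1, Or.inr (Or.inr (Or.inr ?_))⟩; (ext <;> simp); done)
      | (refine ⟨-(e * f), h2, Or.inl ?_⟩; (ext <;> simp); done)
      | (refine ⟨-(e * f), h2, Or.inr (Or.inl ?_)⟩; (ext <;> simp); done)
      | (refine ⟨-(e * f), h2, Or.inr (Or.inr (Or.inl ?_))⟩; (ext <;> simp); done)
      | (refine ⟨-(e * f), h2, Or.inr (Or.inr (Or.inr ?_))⟩; (ext <;> simp); done)

theorem neg_mem_basicQuats {a : Quaternion ℝ} (ha : a ∈ basicQuats) : -a ∈ basicQuats := by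
  obtain ⟨e, he, ha⟩ := ha
  refine ⟨-e, by rcases he with rfl | rfl <;> simp, ?_⟩
  rcases ha with rfl | rfl | rfl | rfl
  · exact Or.inl (by ext <;> simp)
  · exact Or.inr (Or.inl (by ext <;> simp))
  · exact Or.inr (Or.inr (Or.inl (by ext <;> simp)))
  · exact Or.inr (Or.inr (Or.inr (by ext <;> simp)))

open scoped Quaternion in
theorem exists_inv_basicQuats {a : Quaternion ℝ} (ha : a ∈ basicQuats) :
    ∃ b ∈ basicQuats, a * b = 1 := by
  obtain ⟨e, he, ha⟩ := ha
  have h1 : e * e = 1 := by rcases he with rfl | rfl <;> simp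
  have h2 : -e = 1 ∨ -e = -1 := by rcases he with rfl | rfl <;> simp
  rcases ha with rfl | rfl | rfl | rfl
  · exact ⟨quat e 0 0 0, ⟨e, he, Or.inl rfl⟩, by ext <;> simp [h1]⟩
  · exact ⟨quat 0 (-e) 0 0, ⟨-e, h2, Or.inr (Or.inl rfl)⟩, by ext <;> simp [h1]⟩
  · exact ⟨quat 0 0 (-e) 0, ⟨-e, h2, Or.inr (Or.inr (Or.inl rfl))⟩, by ext <;> simp [h1]⟩
  · exact ⟨quat 0 0 0 (-e), ⟨-e, h2, Or.inr (Or.inr (Or.inr rfl))⟩, by ext <;> simp [h1]⟩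

/-- The subgroup `{±1, ±i, ±j, ±k}` of the group of homogeneous invertible quaternions. -/
def basicSubgroup : Subgroup HomQuat where
  carrier := {u | (u.1 : Quaternion ℝ) ∈ basicQuats}
  one_mem' := one_mem_basicQuats
  mul_mem' ha hb := mul_mem_basicQuats ha hb
  inv_mem' := by
    intro u hu
    obtain ⟨b, hb, hab⟩ := exists_inv_basicQuats hu
    have h : ((u.1⁻¹ : (Quaternion ℝ)ˣ) : Quaternion ℝ) = b := Units.inv_eq_of_mul_eq_one_right hab
    change ((u.1⁻¹ : (Quaternion ℝ)ˣ) : Quaternion ℝ) ∈ basicQuats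
    rwa [h]

instance : basicSubgroup.Normal where
  conj_mem := by
    rintro u hu ⟨v, y, hv⟩
    obtain ⟨x, hx⟩ := u.2
    have h := ColorCommutative.comm (lam := quatLam) (𝒜 := quatGrading) y x v hv u.1 hx
    change (v : Quaternion ℝ) * u.1 * (v⁻¹ : (Quaternion ℝ)ˣ) ∈ basicQuats
    rw [h, coe_quatLam, smul_mul_assoc, mul_assoc, Units.mul_inv, mul_one]
    split_ifs
    · rw [one_smul]; exact hu
    · rw [neg_smul, one_smul]; exact neg_mem_basicQuats hu

/-- The inclusion of nonzero real numbers into homogeneous invertible quaternions. -/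
noncomputable def realIncl : ℝˣ →* HomQuat :=
  (Units.map (algebraMap ℝ (Quaternion ℝ) : ℝ →* Quaternion ℝ)).codRestrict
    (homUnits quatGrading) fun a => ⟨0, SetLike.algebraMap_mem_graded quatGrading (a : ℝ)⟩

theorem coe_realIncl (a : ℝˣ) : ((realIncl a).1 : Quaternion ℝ) = quat a 0 0 0 := rfl

theorem signs_le_comap : signs ≤ basicSubgroup.comap realIncl := by
  rintro _ (rfl | rfl)
  · exact ⟨1, Or.inl rfl, Or.inl (by rw [coe_realIncl]; rfl)⟩
  · exact ⟨-1, Or.inr rfl, Or.inl (by rw [coe_realIncl]; rfl)⟩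

theorem realIncl_quotient_bijective :
    Function.Bijective (QuotientGroup.map signs basicSubgroup realIncl signs_le_comap) := by
  constructor
  · rw [injective_iff_map_eq_one]
    intro a
    induction a using QuotientGroup.induction_on with
    | H a =>
    intro h
    rw [QuotientGroup.map_mk, QuotientGroup.eq_one_iff] at h
    rw [QuotientGroup.eq_one_iff]
    obtain ⟨e, he, h⟩ := h
    rw [coe_realIncl] at h
    have ha : (a : ℝ) ≠ 0 := a.ne_zero
    have hae : (a : ℝ) = e := by
      rcases h with h | h | h | h
      · exact congrArg (fun q : Quaternion ℝ => q.re) h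
      all_goals exact absurd (congrArg (fun q : Quaternion ℝ => q.re) h) ha
    rcases he with rfl | rfl
    · exact Or.inl (Units.ext hae)
    · exact Or.inr (Units.ext hae)
  · intro u
    induction u using QuotientGroup.induction_on with
    | H u =>
    obtain ⟨⟨x, hx⟩, h1, h2, h3, h4⟩ := u.2
    have key : ∀ (a : ℝ) (e : Quaternion ℝ), e ∈ basicQuats →
        (u.1 : Quaternion ℝ) = quat a 0 0 0 * e →
        ∃ b, QuotientGroup.map signs basicSubgroup realIncl signs_le_comap b =
          (u : HomQuat ⧸ basicSubgroup) := by
      intro a e he hu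
      have ha : a ≠ 0 := by
        rintro rfl
        have h0 : quat 0 0 0 0 = 0 := rfl
        rw [h0, zero_mul] at hu
        exact u.1.ne_zero hu
      refine ⟨(Units.mk0 a ha : ℝˣ), ?_⟩
      rw [QuotientGroup.map_mk, QuotientGroup.eq]
      have hm : (((realIncl (Units.mk0 a ha))⁻¹ * u : HomQuat).1 : Quaternion ℝ) = e := by
        change (((realIncl (Units.mk0 a ha)).1⁻¹ : (Quaternion ℝ)ˣ) : Quaternion ℝ) * u.1 = e
        rw [hu]
        exact Units.inv_mul_cancel_left (realIncl (Units.mk0 a ha)).1 e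
      change (((realIncl (Units.mk0 a ha))⁻¹ * u : HomQuat).1 : Quaternion ℝ) ∈ basicQuats
      rwa [hm]
    simp only at h1 h2 h3 h4
    rcases hx with rfl | rfl | rfl | rfl <;> simp (decide := true) at h1 h2 h3 h4
    · exact key (u.1 : Quaternion ℝ).re (quat 1 0 0 0) ⟨1, Or.inl rfl, Or.inl rfl⟩
        (by ext <;> simp [*])
    · exact key (u.1 : Quaternion ℝ).imI (quat 0 1 0 0) ⟨1, Or.inl rfl, Or.inr (Or.inl rfl)⟩
        (by ext <;> simp [*])
    · exact key (u.1 : Quaternion ℝ).imJ (quat 0 0 1 0)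
        ⟨1, Or.inl rfl, Or.inr (Or.inr (Or.inl rfl))⟩ (by ext <;> simp [*])
    · exact key (u.1 : Quaternion ℝ).imK (quat 0 0 0 1)
        ⟨1, Or.inl rfl, Or.inr (Or.inr (Or.inr rfl))⟩ (by ext <;> simp [*])

/-- The isomorphism `ℝˣ/{±1} ≃ (ℝˣ ∪ iℝˣ ∪ jℝˣ ∪ kℝˣ)/{±1, ±i, ±j, ±k}` induced by the
inclusion. -/
noncomputable def quotEquiv : ℝˣ ⧸ signs ≃* HomQuat ⧸ basicSubgroup :=
  MulEquiv.ofBijective (QuotientGroup.map signs basicSubgroup realIncl signs_le_comap)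
    realIncl_quotient_bijective

/-- The quotient map from homogeneous invertible quaternions onto
`(ℝˣ ∪ iℝˣ ∪ jℝˣ ∪ kℝˣ)/{±1, ±i, ±j, ±k}`, identified with `ℝˣ/{±1}`. -/
noncomputable def quotMap : HomQuat →* ℝˣ ⧸ signs :=
  quotEquiv.symm.toMonoidHom.comp (QuotientGroup.mk' basicSubgroup)

/-- The invertible diagonal matrix with entry `a` at the position `i` and `1` elsewhere. -/
noncomputable def diagUnit {n : ℕ} (i : Fin n) (a : (Quaternion ℝ)ˣ) : GL (Fin n) (Quaternion ℝ) where
  val := Matrix.diagonal (Function.update 1 i (a : Quaternion ℝ))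
  inv := Matrix.diagonal (Function.update 1 i ((a⁻¹ : (Quaternion ℝ)ˣ) : Quaternion ℝ))
  val_inv := by
    rw [Matrix.diagonal_mul_diagonal, ← Matrix.diagonal_one]
    congr 1; ext1 j
    rcases eq_or_ne j i with rfl | h <;> simp [*]
  inv_val := by
    rw [Matrix.diagonal_mul_diagonal, ← Matrix.diagonal_one]
    congr 1; ext1 j
    rcases eq_or_ne j i with rfl | h <;> simp [*]

/-- The defining property of the Dieudonné determinant over the quaternions: a group morphism to
`ℝˣ/{±1}` sending `diag(1, …, 1, a)` to the class of `a` for all nonzero real `a`. (For `n = 0`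
there is no last diagonal position, and the group `GL(0)` is trivial.) -/
def IsDieudonneDet {n : ℕ} (D : GL (Fin n) (Quaternion ℝ) →* ℝˣ ⧸ signs) : Prop :=
  ∀ i : Fin n, (i : ℕ) + 1 = n → ∀ a : ℝˣ,
    D (diagUnit i (Units.map (algebraMap ℝ (Quaternion ℝ) : ℝ →* Quaternion ℝ) a)) =
      (a : ℝˣ ⧸ signs)

end GradedDet

/-! The target ℝˣ/{±1} is abelian and squaring is injective on it, which forces the values of any
morphism `D` with the prescribed normalization. Gaussian elimination generates GL(n, ℍ) by
transpositions, elimination matrices and dilations. A transposition is an involution, so its image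
is trivial. An elimination matrix is conjugate to its own square, so its image is trivial too. A
dilation by q is conjugate to the dilation by q̄, and q̄q = ‖q‖², so its image squares to the class
of ‖q‖² and is the class of ‖q‖. Existence comes from an explicit formula: the class of |det_ℝ
X|^(1/4), where X acts on ℍⁿ = ℝ⁴ⁿ.

For the graded determinant, `J_mul` gives J(X)J(Y) = ς(x,y) J(XY). Taking determinants leaves
ς(x,y)ⁿ on one side; since Gdet X has degree nx, untwisting the product leaves ς(x,y)^(n²) on the
other. Γ has exponent 2, so ς takes values ±1; as n² and n have the same parity, the two factors
cancel.

The comparison is made over ℝ. By `J_mulVec`, J(X) differs from X, as a real operator, only by sign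
changes of graded coordinates on both sides, so det_ℝ J(X) = ± det_ℝ X. But det_ℝ J(X) is also the
norm of the element det J(X) of the commutative twisted algebra, and the norm of a homogeneous q is
±‖q‖⁴. Hence ‖Gdet X‖⁴ = |det_ℝ X|, and the quotient map sends a homogeneous unit u to the class of
‖u‖ (`quotMap_eq_mk_normUnit`). -/

namespace GradedDet

/-! ### Generators of the general linear group of a division ring -/

section Generators

variable {n R : Type*} [DecidableEq n] [Ring R]

/-- The matrix with column `c` at the position `k` and zero elsewhere. -/
def colMatrix (k : n) (c : n → R) : Matrix n n R := Matrix.of fun i j => if j = k then c i else 0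

theorem colMatrix_add (k : n) (c d : n → R) :
    colMatrix k (c + d) = colMatrix k c + colMatrix k d := by
  ext i j
  by_cases h : j = k <;> simp [colMatrix, h]

variable [Fintype n]

/-- The permutation matrix of a transposition, as an invertible matrix. -/
def swapUnit (R : Type*) [Ring R] (i j : n) : GL n R where
  val := Matrix.swap R i j
  inv := Matrix.swap R i j
  val_inv := Matrix.swap_mul_self i j
  inv_val := Matrix.swap_mul_self i j

theorem swapUnit_mul_self (i j : n) : swapUnit R i j * swapUnit R i j = 1 :=
  Units.ext (Matrix.swap_mul_self i j)

theorem colMatrix_mul_apply (k : n) (c : n → R) (Y : Matrix n n R) (i j : n) :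
    (colMatrix k c * Y) i j = c i * Y k j := by
  simp [colMatrix, Matrix.mul_apply]

/-- (c eₖᵀ)(d eₖᵀ) = c dₖ eₖᵀ. This makes c ↦ 1 + c eₖᵀ additive on columns vanishing at k, with
inverse 1 − c eₖᵀ. -/
theorem colMatrix_mul_colMatrix {k : n} {d : n → R} (hd : d k = 0) (c : n → R) :
    colMatrix k c * colMatrix k d = 0 := by
  ext i j
  rw [colMatrix_mul_apply]
  simp [colMatrix, hd]

/-- The elimination matrix `1 + c eₖᵀ`, where `c k = 0`. -/
def elimUnit (k : n) (c : n → R) (hc : c k = 0) : GL n R where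
  val := 1 + colMatrix k c
  inv := 1 - colMatrix k c
  val_inv := by rw [mul_sub, add_mul, add_mul, colMatrix_mul_colMatrix hc]; simp
  inv_val := by rw [mul_add, sub_mul, sub_mul, colMatrix_mul_colMatrix hc]; simp

theorem coe_elimUnit (k : n) (c : n → R) (hc : c k = 0) :
    (elimUnit k c hc : Matrix n n R) = 1 + colMatrix k c := rfl

theorem elimUnit_mul_self (k : n) (c : n → R) (hc : c k = 0) :
    elimUnit k c hc * elimUnit k c hc = elimUnit k (c + c) (by simp [hc]) := by
  ext1
  rw [Units.val_mul, coe_elimUnit, coe_elimUnit, colMatrix_add, mul_add, add_mul, add_mul,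
    colMatrix_mul_colMatrix hc]
  simp [add_assoc]

/-- The diagonal matrices with entry `a` at the position `i` and `1` elsewhere. -/
def dilation (i : n) : Rˣ →* GL n R :=
  (Units.map (Matrix.diagonalRingHom n R : (n → R) →* Matrix n n R)).comp
    (MulEquiv.piUnits.symm.toMonoidHom.comp (MonoidHom.mulSingle (fun _ : n => Rˣ) i))

theorem coe_dilation (i : n) (a : Rˣ) :
    (dilation i a : Matrix n n R) = Matrix.diagonal (Function.update 1 i (a : R)) := by
  change Matrix.diagonal _ = _
  congr 1
  ext j
  rcases eq_or_ne j i with rfl | h <;> simp [*]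

theorem dilation_mul_apply (i : n) (a : Rˣ) (Y : Matrix n n R) (k l : n) :
    ((dilation i a : Matrix n n R) * Y) k l = if k = i then a * Y k l else Y k l := by
  rw [coe_dilation, Matrix.diagonal_mul]
  split_ifs with h <;> simp [h]

theorem mul_dilation_apply (i : n) (a : Rˣ) (Y : Matrix n n R) (k l : n) :
    (Y * (dilation i a : Matrix n n R)) k l = if l = i then Y k l * a else Y k l := by
  rw [coe_dilation, Matrix.mul_diagonal]
  split_ifs with h <;> simp [h]

/-- Conjugation by a transposition moves a dilation to another diagonal position; it reduces all
positions to the last one, where the Dieudonné determinant is normalized. -/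
theorem swapUnit_mul_dilation (i j : n) (a : Rˣ) :
    swapUnit R i j * dilation i a = dilation j a * swapUnit R i j := by
  ext k l
  rw [Units.val_mul, Units.val_mul, mul_dilation_apply, dilation_mul_apply]
  change (if l = i then Matrix.swap R i j k l * a else Matrix.swap R i j k l) =
    if k = j then a * Matrix.swap R i j k l else Matrix.swap R i j k l
  simp only [Matrix.swap, Equiv.Perm.permMatrix, PEquiv.toMatrix_apply, Equiv.toPEquiv_apply,
    Option.mem_def, Option.some.injEq]
  rcases eq_or_ne l i with rfl | hl
  · rcases eq_or_ne k j with rfl | hk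
    · simp
    · simp [hk, Equiv.swap_apply_eq_iff]
  · rcases eq_or_ne k j with rfl | hk
    · simp [hl, hl.symm]
    · simp [hk, hl]

/-- Right multiplication by the dilation rescales column k, while left multiplication only touches
row k, where c vanishes. With a = 2 this conjugates an elimination matrix into its square. -/
theorem elimUnit_mul_dilation (k : n) (c : n → R) (hc : c k = 0) (a : Rˣ) :
    elimUnit k c hc * dilation k a =
      dilation k a * elimUnit k (fun i => c i * a) (by simp [hc]) := by
  ext i j
  rw [Units.val_mul, Units.val_mul, mul_dilation_apply, dilation_mul_apply, coe_elimUnit,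
    coe_elimUnit]
  simp only [Matrix.add_apply, Matrix.one_apply, colMatrix, Matrix.of_apply]
  rcases eq_or_ne j k with rfl | hj
  · rcases eq_or_ne i j with rfl | hi
    · simp [hc]
    · simp [hi]
  · rcases eq_or_ne i k with rfl | hi
    · simp [hj, hj.symm]
    · simp [hj, hi]

end Generators

/-! ### Gaussian elimination over a division ring -/

section DivisionRing

variable {n : ℕ} {R : Type*} [DivisionRing R]

/-- Gauss elimination: a subgroup of `GL(n, R)` containing the transpositions, the elimination
matrices and the dilations is the whole group. -/
theorem eq_top_of_generators_mem (S : Subgroup (GL (Fin n) R))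
    (hswap : ∀ i j, swapUnit R i j ∈ S) (helim : ∀ k c hc, elimUnit k c hc ∈ S)
    (hdil : ∀ i a, dilation i a ∈ S) : S = ⊤ := by
  -- Induction on the number m of columns still to be cleared; the first k columns already agree
  -- with those of the identity.
  have key : ∀ m k : ℕ, k + m = n → ∀ X : GL (Fin n) R,
      (∀ i j : Fin n, (j : ℕ) < k → X.val i j = (1 : Matrix (Fin n) (Fin n) R) i j) → X ∈ S := by
    intro m
    induction m with
    | zero =>
      intro k hk X hX
      have : X = 1 := Units.ext (Matrix.ext fun i j => hX i j (by have := j.2; omega))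
      exact this ▸ S.one_mem
    | succ m ih =>
      intro k hk X hX
      let p : Fin n := ⟨k, by omega⟩
      obtain ⟨r, hr, hrp⟩ : ∃ r : Fin n, k ≤ r ∧ X.val r p ≠ 0 := by
        by_contra! h
        -- Without a pivot, column k would be a right combination of the first k unit columns, so
        -- this nonzero vector would lie in the kernel of X.
        let v : Fin n → R := fun j => if j = p then 1 else if (j : ℕ) < k then -X.val j p else 0
        have hv : X.val.mulVec v = 0 := by
          ext i
          have h1 : ∀ j, X.val i j * v j = (if j = p then X.val i p else 0) +
              (if j = i then (if (j : ℕ) < k then -X.val i p else 0) else 0) := by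
            intro j
            simp only [v]
            by_cases hjp : j = p
            · subst hjp; simp [p]
            · by_cases hjk : (j : ℕ) < k
              · rw [hX i j hjk, Matrix.one_apply]
                rcases eq_or_ne i j with rfl | hij
                · simp [hjp, hjk]
                · simp [hjp, hij, hij.symm]
              · simp [hjp, hjk]
          rw [Matrix.mulVec, dotProduct, Finset.sum_congr rfl fun j _ => h1 j,
            Finset.sum_add_distrib]
          simp only [Finset.sum_ite_eq', Finset.mem_univ, if_true, Pi.zero_apply]
          split_ifs with hik
          · simp
          · simpa using h i (by omega)
        have h0 : v = 0 := by
          calc v = ((X⁻¹).val * X.val).mulVec v := by rw [Units.inv_mul, Matrix.one_mulVec]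
            _ = 0 := by rw [← Matrix.mulVec_mulVec, hv, Matrix.mulVec_zero]
        have := congrFun h0 p
        simp [v] at this
      let Y : GL (Fin n) R := swapUnit R p r * X
      have hYk : Y.val p p ≠ 0 := by
        change (Matrix.swap R p r * X.val) p p ≠ 0
        rwa [Matrix.swap_mul_apply_left]
      -- Both swapped rows have index at least k, so the cleared columns, which vanish in those
      -- rows, are preserved.
      have hY : ∀ i j : Fin n, (j : ℕ) < k →
          Y.val i j = (1 : Matrix (Fin n) (Fin n) R) i j := by
        intro i j hj
        change (Matrix.swap R p r * X.val) i j = _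
        have hjp : j ≠ p := by rintro rfl; simp [p] at hj
        have hjr : j ≠ r := by rintro rfl; omega
        rcases eq_or_ne i p with rfl | hip
        · rw [Matrix.swap_mul_apply_left, hX _ _ hj, Matrix.one_apply_ne hjr.symm,
            Matrix.one_apply_ne hjp.symm]
        rcases eq_or_ne i r with rfl | hir
        · rw [Matrix.swap_mul_apply_right, hX _ _ hj, Matrix.one_apply_ne hjr.symm,
            Matrix.one_apply_ne hjp.symm]
        rw [Matrix.swap_mul_of_ne hip hir, hX _ _ hj]
      let Z : GL (Fin n) R := dilation p (Units.mk0 _ hYk)⁻¹ * Y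
      have hZk : Z.val p p = 1 := by
        rw [Units.val_mul, dilation_mul_apply, if_pos rfl]
        exact (Units.mk0 _ hYk).inv_mul
      have hZ : ∀ i j : Fin n, (j : ℕ) < k →
          Z.val i j = (1 : Matrix (Fin n) (Fin n) R) i j := by
        intro i j hj
        have hjp : j ≠ p := by rintro rfl; simp [p] at hj
        rw [Units.val_mul, dilation_mul_apply, hY i j hj]
        split_ifs with hi
        · rw [hi, Matrix.one_apply_ne hjp.symm, mul_zero]
        · rfl
      -- Clears column k both above and below the pivot, so the process ends at the identity and not
      -- merely at a triangular matrix.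
      let c : Fin n → R := fun i => if i = p then 0 else -Z.val i p
      have hc : c p = 0 := if_pos rfl
      have hW : elimUnit p c hc * Z ∈ S := by
        refine ih (k + 1) (by omega) _ fun i j hj => ?_
        rw [Units.val_mul, coe_elimUnit, add_mul, one_mul, Matrix.add_apply, colMatrix_mul_apply]
        rcases Nat.lt_succ_iff_lt_or_eq.1 hj with hj | hj
        · have hjp : j ≠ p := by rintro rfl; simp [p] at hj
          rw [hZ i j hj, hZ p j hj, Matrix.one_apply_ne hjp.symm, mul_zero, add_zero]
        · rw [show j = p from Fin.ext hj, hZk, mul_one]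
          rcases eq_or_ne i p with hij | hij
          · rw [hij, hc, hZk, Matrix.one_apply_eq, add_zero]
          · simp only [c]
            rw [if_neg hij, Matrix.one_apply_ne hij, add_neg_cancel]
      rw [S.mul_mem_cancel_left (helim _ _ _), S.mul_mem_cancel_left (hdil _ _),
        S.mul_mem_cancel_left (hswap _ _)] at hW
      exact hW
  exact (Subgroup.eq_top_iff' S).2 fun X => key n 0 (by omega) X fun i j hj => absurd hj (by omega)

end DivisionRing

/-! ### Uniqueness of the Dieudonné determinant -/

theorem diagUnit_eq_dilation {n : ℕ} (i : Fin n) (a : (Quaternion ℝ)ˣ) :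
    diagUnit i a = dilation i a := by
  ext1
  rw [coe_dilation]
  rfl

/-- A real square is never −1, so a² = ±1 already forces a = ±1. -/
theorem eq_one_of_mul_self_eq_one {x : ℝˣ ⧸ signs} (h : x * x = 1) : x = 1 := by
  induction x using QuotientGroup.induction_on with
  | H a =>
  rw [← QuotientGroup.mk_mul, QuotientGroup.eq_one_iff] at h
  rw [QuotientGroup.eq_one_iff]
  have h2 : (a : ℝ) * a = 1 := by
    rcases h with h | h
    · simpa using congrArg Units.val h
    · have := congrArg Units.val h
      simp only [Units.val_mul, Units.val_neg, Units.val_one] at this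
      nlinarith [mul_self_nonneg (a : ℝ)]
  rcases mul_self_eq_one_iff.1 h2 with h | h
  · exact Or.inl (Units.ext h)
  · exact Or.inr (Units.ext h)

theorem signsQuotient_mul_comm (x y : ℝˣ ⧸ signs) : x * y = y * x := by
  induction x using QuotientGroup.induction_on with
  | H a =>
  induction y using QuotientGroup.induction_on with
  | H b => rw [← QuotientGroup.mk_mul, mul_comm, QuotientGroup.mk_mul]

theorem eq_of_mul_self_eq_mul_self {x y : ℝˣ ⧸ signs} (h : x * x = y * y) : x = y := by
  rw [← mul_inv_eq_one]
  refine eq_one_of_mul_self_eq_one ?_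
  rw [mul_assoc, signsQuotient_mul_comm y⁻¹, mul_assoc, ← mul_assoc x, h, mul_assoc,
    mul_inv_cancel_left, mul_inv_cancel]

theorem eq_of_mul_eq_mul_comm {x y z : ℝˣ ⧸ signs} (h : z * x = y * z) : x = y := by
  rw [← inv_mul_cancel_left z x, h, signsQuotient_mul_comm y, inv_mul_cancel_left]

/-- Every quaternion is conjugate to its conjugate. -/
theorem exists_mul_eq_star_mul (q : Quaternion ℝ) : ∃ p : (Quaternion ℝ)ˣ, p * q = star q * p := by
  suffices h : ∃ p : Quaternion ℝ, p ≠ 0 ∧ p * q = star q * p by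
    obtain ⟨p, hp, h⟩ := h
    exact ⟨Units.mk0 p hp, h⟩
  -- A nonzero pure quaternion orthogonal to the imaginary part of q anticommutes with it and so
  -- conjugates q to q̄. The choice −c i + b j for q = a + b i + c j + d k works unless b = c = 0,
  -- where i does.
  by_cases h : q.imI = 0 ∧ q.imJ = 0
  · refine ⟨quat 0 1 0 0, fun h0 => one_ne_zero (congrArg (fun q : Quaternion ℝ => q.imI) h0), ?_⟩
    ext <;> simp [h.1, h.2]
  · refine ⟨quat 0 (-q.imJ) q.imI 0, fun h0 => h ⟨congrArg (fun q : Quaternion ℝ => q.imJ) h0, ?_⟩,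
      ?_⟩
    · exact neg_eq_zero.1 (congrArg (fun q : Quaternion ℝ => q.imI) h0)
    · ext <;> simp <;> ring

/-- The norm of an invertible quaternion, as an invertible real number. -/
noncomputable def normUnit (q : (Quaternion ℝ)ˣ) : ℝˣ := Units.mk0 ‖(q : Quaternion ℝ)‖ (by simp)

/-- The embedding of the group of nonzero reals into the group of nonzero quaternions. -/
noncomputable abbrev realUnits : ℝˣ →* (Quaternion ℝ)ˣ :=
  Units.map (algebraMap ℝ (Quaternion ℝ) : ℝ →* Quaternion ℝ)

theorem star_mul_self_eq_realUnits (q : (Quaternion ℝ)ˣ) :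
    star q * q = realUnits (normUnit q) * realUnits (normUnit q) := by
  ext1
  have h : ((realUnits (normUnit q) : (Quaternion ℝ)ˣ) : Quaternion ℝ) =
      ((‖(q : Quaternion ℝ)‖ : ℝ) : Quaternion ℝ) := rfl
  rw [Units.val_mul, Units.val_mul, h, Units.coe_star, Quaternion.star_mul_self,
    Quaternion.normSq_eq_norm_mul_self, Quaternion.coe_mul]

/-- The dilations by q and q̄ are conjugate, so they have equal images in an abelian group; their
product is the dilation by the real number ‖q‖², where the value is prescribed. Injectivity of
squaring removes the square. -/
theorem IsDieudonneDet.map_dilation {n : ℕ} {D : GL (Fin n) (Quaternion ℝ) →* ℝˣ ⧸ signs}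
    (hD : IsDieudonneDet D) (i : Fin n) (q : (Quaternion ℝ)ˣ) :
    D (dilation i q) = (normUnit q : ℝˣ ⧸ signs) := by
  have hpos : 0 < n := i.pos
  have hreal : ∀ a : ℝˣ, D (dilation i (realUnits a)) = (a : ℝˣ ⧸ signs) := by
    intro a
    have h := congrArg D (swapUnit_mul_dilation i ⟨n - 1, by omega⟩ (realUnits a))
    rw [map_mul, map_mul] at h
    rw [eq_of_mul_eq_mul_comm h, ← diagUnit_eq_dilation]
    exact hD ⟨n - 1, by omega⟩ (Nat.sub_add_cancel hpos) a
  obtain ⟨p, hp⟩ := exists_mul_eq_star_mul (q : Quaternion ℝ)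
  have hp' : p * q = star q * p := Units.ext hp
  have h := congrArg (fun u => D (dilation i u)) hp'
  simp only [map_mul] at h
  refine eq_of_mul_self_eq_mul_self ?_
  nth_rw 1 [eq_of_mul_eq_mul_comm h]
  rw [← map_mul, ← map_mul, star_mul_self_eq_realUnits, map_mul, map_mul, hreal]

theorem map_swapUnit {n : ℕ} (D : GL (Fin n) (Quaternion ℝ) →* ℝˣ ⧸ signs) (i j : Fin n) :
    D (swapUnit _ i j) = 1 :=
  eq_one_of_mul_self_eq_one (by rw [← map_mul, swapUnit_mul_self, map_one])

/-- Conjugation by the dilation by 2 replaces c by c + c, that is, squares the elimination matrix.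
In an abelian target its image equals its own square, hence is trivial. -/
theorem map_elimUnit {n : ℕ} (D : GL (Fin n) (Quaternion ℝ) →* ℝˣ ⧸ signs) (k : Fin n)
    (c : Fin n → Quaternion ℝ) (hc : c k = 0) : D (elimUnit k c hc) = 1 := by
  have h2 : (2 : Quaternion ℝ) ≠ 0 := fun h => two_ne_zero (congrArg (fun q => q.re) h : (2 : ℝ) = 0)
  have h := congrArg D (elimUnit_mul_dilation k c hc (Units.mk0 2 h2))
  have hcc : (fun i => c i * ((Units.mk0 2 h2 : (Quaternion ℝ)ˣ) : Quaternion ℝ)) =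
      c + c := by
    ext1 i
    exact mul_two (c i)
  simp only [hcc] at h
  rw [← elimUnit_mul_self k c hc, map_mul, map_mul, map_mul] at h
  have h' := eq_of_mul_eq_mul_comm h.symm
  exact eq_of_mul_eq_mul_comm (h'.trans (one_mul (D (elimUnit k c hc))).symm)

theorem IsDieudonneDet.unique {n : ℕ} {D D' : GL (Fin n) (Quaternion ℝ) →* ℝˣ ⧸ signs}
    (hD : IsDieudonneDet D) (hD' : IsDieudonneDet D') : D = D' := by
  have h : D.eqLocus D' = ⊤ := by
    refine eq_top_of_generators_mem _ (fun i j => ?_) (fun k c hc => ?_) fun i a => ?_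
    · exact (map_swapUnit D i j).trans (map_swapUnit D' i j).symm
    · exact (map_elimUnit D k c hc).trans (map_elimUnit D' k c hc).symm
    · exact (hD.map_dilation i a).trans (hD'.map_dilation i a).symm
  exact MonoidHom.eq_of_eqOn_top fun X _ => (h ▸ Subgroup.mem_top X : X ∈ D.eqLocus D')

/-! ### The twisted algebra and the graded determinant -/

section NSMultiplier

variable {Γ K : Type*} [AddCommGroup Γ] [Field K] {lam : Γ → Γ → Kˣ} (s : NSMultiplier lam)

theorem NSMultiplier.map_neg_left (x y : Γ) : s.toFun (-x) y = (s.toFun x y)⁻¹ := by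
  rw [eq_inv_iff_mul_eq_one, ← s.map_add_left, neg_add_cancel, s.zero_left]

theorem NSMultiplier.map_neg_right (x y : Γ) : s.toFun x (-y) = (s.toFun x y)⁻¹ := by
  rw [eq_inv_iff_mul_eq_one, ← s.map_add_right, neg_add_cancel, s.zero_right]

theorem NSMultiplier.map_sub_left (x y z : Γ) :
    s.toFun (x - y) z = s.toFun x z * (s.toFun y z)⁻¹ := by
  rw [sub_eq_add_neg, s.map_add_left, s.map_neg_left]

theorem NSMultiplier.map_sub_right (x y z : Γ) :
    s.toFun x (y - z) = s.toFun x y * (s.toFun x z)⁻¹ := by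
  rw [sub_eq_add_neg, s.map_add_right, s.map_neg_right]

theorem NSMultiplier.map_nsmul_left (n : ℕ) (x y : Γ) :
    s.toFun (n • x) y = s.toFun x y ^ n := by
  induction n with
  | zero => rw [zero_smul, s.zero_left, pow_zero]
  | succ n ih => rw [succ_nsmul, s.map_add_left, ih, pow_succ]

theorem NSMultiplier.map_nsmul_right (n : ℕ) (x y : Γ) :
    s.toFun x (n • y) = s.toFun x y ^ n := by
  induction n with
  | zero => rw [zero_smul, s.zero_right, pow_zero]
  | succ n ih => rw [succ_nsmul, s.map_add_right, ih, pow_succ]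

end NSMultiplier

section HomogeneousMatrix

variable {Γ K A : Type*} [AddCommGroup Γ] [DecidableEq Γ] [Field K] [Ring A] [Algebra K A]
  (𝒜 : Γ → Submodule K A) [GradedAlgebra 𝒜] {n : ℕ} (ν : Fin n → Γ)

variable {𝒜 ν} in
theorem IsHomogeneousMatrix.mul {x y : Γ} {X Y : Matrix (Fin n) (Fin n) A}
    (hX : IsHomogeneousMatrix 𝒜 ν x X) (hY : IsHomogeneousMatrix 𝒜 ν y Y) :
    IsHomogeneousMatrix 𝒜 ν (x + y) (X * Y) := by
  intro i j
  rw [Matrix.mul_apply]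
  refine Submodule.sum_mem _ fun k _ => ?_
  have h := SetLike.GradedMul.mul_mem (hX i k) (hY k j)
  rwa [show x - ν i + ν k + (y - ν k + ν j) = x + y - ν i + ν j by abel] at h

theorem isHomogeneousMatrix_one : IsHomogeneousMatrix 𝒜 ν 0 1 := by
  intro i j
  rcases eq_or_ne i j with rfl | h
  · simpa using (SetLike.GradedOne.one_mem : (1 : A) ∈ 𝒜 0)
  · simp [Matrix.one_apply_ne h]

end HomogeneousMatrix

section Twisted

variable {Γ K A : Type*} [AddCommGroup Γ] [DecidableEq Γ] [Fintype Γ] [Field K] [Ring A]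
  [Algebra K A] {lam : Γ → Γ → Kˣ} (𝒜 : Γ → Submodule K A) [GradedAlgebra 𝒜]
  (s : NSMultiplier lam)

theorem twistMul_smul_left (r : K) (a b : A) :
    twistMul 𝒜 s (r • a) b = r • twistMul 𝒜 s a b := by
  simp [twistMul, Finset.smul_sum, smul_comm r, -GradedAlgebra.proj_apply]

theorem twistMul_smul_right (r : K) (a b : A) :
    twistMul 𝒜 s a (r • b) = r • twistMul 𝒜 s a b := by
  simp [twistMul, Finset.smul_sum, smul_comm r, -GradedAlgebra.proj_apply]

/-- The linear map multiplying the elements of degree `x` by `c x`. -/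
noncomputable def gradedScale (c : Γ → K) : A →ₗ[K] A := ∑ x, c x • GradedAlgebra.proj 𝒜 x

theorem gradedScale_of_mem (c : Γ → K) {x : Γ} {a : A} (ha : a ∈ 𝒜 x) :
    gradedScale 𝒜 c a = c x • a := by
  rw [gradedScale, LinearMap.sum_apply, Finset.sum_eq_single x]
  · rw [LinearMap.smul_apply, proj_of_mem 𝒜 ha, if_pos rfl]
  · intro y _ hy
    rw [LinearMap.smul_apply, proj_of_mem 𝒜 ha, if_neg hy, smul_zero]
  · simp

theorem gradedScale_gradedScale {c : Γ → K} (hc : ∀ x, c x * c x = 1) (a : A) :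
    gradedScale 𝒜 c (gradedScale 𝒜 c a) = a := by
  induction a using DirectSum.Decomposition.inductionOn 𝒜 with
  | zero => simp
  | add a b ha hb => simp only [map_add, ha, hb]
  | homogeneous a =>
    rw [gradedScale_of_mem 𝒜 c a.2, map_smul, gradedScale_of_mem 𝒜 c a.2, smul_smul, hc, one_smul]

/-- The linear map multiplying the component of degree `x` of the `i`-th coordinate by `c i x`. -/
noncomputable def diagScale {n : ℕ} (c : Fin n → Γ → K) : (Fin n → A) →ₗ[K] (Fin n → A) :=
  LinearMap.pi fun i => gradedScale 𝒜 (c i) ∘ₗ LinearMap.proj i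

theorem diagScale_apply {n : ℕ} (c : Fin n → Γ → K) (v : Fin n → A) (i : Fin n) :
    diagScale 𝒜 c v i = gradedScale 𝒜 (c i) (v i) := rfl

/-- A scaling by signs is an involution, so it affects determinants only by a sign. -/
theorem det_diagScale_mul_self {n : ℕ} {c : Fin n → Γ → K} (hc : ∀ i x, c i x * c i x = 1) :
    LinearMap.det (diagScale 𝒜 c) * LinearMap.det (diagScale 𝒜 c) = 1 := by
  rw [← LinearMap.det_comp, ← LinearMap.det_id (A := K) (M := Fin n → A)]
  congr 1
  exact LinearMap.ext fun v => funext fun i => gradedScale_gradedScale 𝒜 (hc i) (v i)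

variable [PurelyEven lam] [ColorCommutative lam 𝒜]

/-- Provides the norm of the twisted algebra over the ground field. -/
noncomputable instance : Algebra K (Twisted 𝒜 s) :=
  Algebra.ofModule (twistMul_smul_left 𝒜 s) (fun r a b => twistMul_smul_right 𝒜 s r a b)

theorem toTwisted_mul_toTwisted (a b : A) :
    toTwisted 𝒜 s a * toTwisted 𝒜 s b = toTwisted 𝒜 s (twistMul 𝒜 s a b) := rfl

theorem toTwisted_one : toTwisted 𝒜 s 1 = 1 := rfl

/-- The grading of the twisted algebra. -/
noncomputable def twistedGrading (x : Γ) : Submodule K (Twisted 𝒜 s) := (𝒜 x).map (toTwisted 𝒜 s).toLinearMap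

variable {𝒜} in
theorem toTwisted_mem {x : Γ} {a : A} (ha : a ∈ 𝒜 x) : toTwisted 𝒜 s a ∈ twistedGrading 𝒜 s x :=
  ⟨a, ha, rfl⟩

/-- On homogeneous elements the twist only rescales products, so degrees still add; this controls
the degree of each term of the Leibniz formula. -/
instance : SetLike.GradedMonoid (twistedGrading 𝒜 s) where
  one_mem := toTwisted_mem s (SetLike.GradedOne.one_mem : (1 : A) ∈ 𝒜 0)
  mul_mem := by
    rintro x y _ _ ⟨a, ha, rfl⟩ ⟨b, hb, rfl⟩
    refine ⟨_, (𝒜 (x + y)).smul_mem (s.toFun x y : K) (SetLike.GradedMul.mul_mem ha hb), ?_⟩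
    rw [← twistMul_of_mem 𝒜 s ha hb]
    rfl

variable {n : ℕ} (ν : Fin n → Γ)

variable {𝒜 ν} in
-- The factors in J are such that, by biadditivity, the dependence on the summation index k cancels
-- against the twist of the product; only ς(x,y) remains.
theorem J_mul {x y : Γ} {X Y : Matrix (Fin n) (Fin n) A}
    (hX : IsHomogeneousMatrix 𝒜 ν x X) (hY : IsHomogeneousMatrix 𝒜 ν y Y) :
    J 𝒜 s ν X * J 𝒜 s ν Y = (s.toFun x y : K) • J 𝒜 s ν (X * Y) := by
  ext i j
  rw [Matrix.mul_apply, Matrix.smul_apply, J_of_isHomogeneousMatrix 𝒜 s ν (hX.mul hY),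
    Matrix.mul_apply, map_sum, Finset.smul_sum, Finset.smul_sum]
  refine Finset.sum_congr rfl fun k _ => ?_
  rw [J_of_isHomogeneousMatrix 𝒜 s ν hX, J_of_isHomogeneousMatrix 𝒜 s ν hY, smul_mul_smul_comm,
    toTwisted_mul_toTwisted, twistMul_of_mem 𝒜 s (hX i k) (hY k j), map_smul, smul_smul, smul_smul]
  congr 1
  rw [← Units.val_mul, ← Units.val_mul, ← Units.val_mul]
  congr 1
  simp only [s.map_add_left, s.map_add_right, s.map_sub_left, s.map_sub_right]
  apply Units.ext
  simp only [Units.val_mul, Units.val_inv_eq_inv_val]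
  field_simp

theorem J_one : J 𝒜 s ν 1 = 1 := by
  ext i j
  rw [J_of_isHomogeneousMatrix 𝒜 s ν (isHomogeneousMatrix_one 𝒜 ν)]
  rcases eq_or_ne i j with rfl | h
  · rw [Matrix.one_apply_eq, Matrix.one_apply_eq, zero_sub, neg_add_cancel, s.zero_left,
      s.zero_right, inv_one, mul_one, Units.val_one, one_smul]
    rfl
  · rw [Matrix.one_apply_ne h, Matrix.one_apply_ne h, map_zero, smul_zero]

theorem Gdet_one : Gdet 𝒜 s ν 1 = 1 := by
  rw [Gdet, J_one, Matrix.det_one]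
  rfl

variable {𝒜 ν} in
theorem Gdet_mem {x : Γ} {X : Matrix (Fin n) (Fin n) A} (hX : IsHomogeneousMatrix 𝒜 ν x X) :
    Gdet 𝒜 s ν X ∈ 𝒜 (n • x) := by
  have h : (J 𝒜 s ν X).det ∈ twistedGrading 𝒜 s (n • x) := by
    rw [Matrix.det_apply]
    refine Submodule.sum_mem _ fun σ _ => ?_
    have hprod : ∏ i, J 𝒜 s ν X (σ i) i ∈ twistedGrading 𝒜 s (n • x) := by
      -- The shifts by ν cancel along any permutation, so every Leibniz term has the same degree.
      have hsum : ∑ i, (x - ν (σ i) + ν i) = n • x := by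
        rw [Finset.sum_add_distrib, Finset.sum_sub_distrib, Equiv.sum_comp σ ν]
        simp
      rw [← hsum]
      refine SetLike.prod_mem_graded _ _ _ fun i _ => ?_
      rw [J_of_isHomogeneousMatrix 𝒜 s ν hX]
      exact Submodule.smul_mem _ _ (toTwisted_mem s (hX _ _))
    rcases Int.units_eq_one_or (Equiv.Perm.sign σ) with h | h <;> rw [h]
    · rwa [one_smul]
    · rw [Units.neg_smul, one_smul]
      exact Submodule.neg_mem _ hprod
  obtain ⟨a, ha, h⟩ := h
  rw [Gdet, ← h]
  exact ha

variable {𝒜 ν} in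
/-- The graded determinant is multiplicative on homogeneous matrices, if the values of the
NS-multiplier are signs. -/
theorem Gdet_mul {x y : Γ} {X Y : Matrix (Fin n) (Fin n) A}
    (hX : IsHomogeneousMatrix 𝒜 ν x X) (hY : IsHomogeneousMatrix 𝒜 ν y Y)
    (hs : s.toFun x y * s.toFun x y = 1) :
    Gdet 𝒜 s ν (X * Y) = Gdet 𝒜 s ν X * Gdet 𝒜 s ν Y := by
  have h1 : twistMul 𝒜 s (Gdet 𝒜 s ν X) (Gdet 𝒜 s ν Y) =
      (s.toFun x y : K) ^ n • Gdet 𝒜 s ν (X * Y) := by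
    have h := congrArg Matrix.det (J_mul s hX hY)
    rw [Matrix.det_mul, Matrix.det_smul_of_tower, Fintype.card_fin] at h
    exact h
  rw [twistMul_of_mem 𝒜 s (Gdet_mem s hX) (Gdet_mem s hY), s.map_nsmul_left,
    s.map_nsmul_right] at h1
  -- n² and n have the same parity, and the value of ς is a sign.
  have h2 : (s.toFun x y ^ n) ^ n = s.toFun x y ^ n := by
    rcases Nat.even_or_odd' n with ⟨k, hk | hk⟩
    · have : s.toFun x y ^ n = 1 := by rw [hk, pow_mul, pow_two, hs, one_pow]
      rw [this, one_pow]
    · have : s.toFun x y ^ n = s.toFun x y := by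
        rw [hk, pow_succ, pow_mul, pow_two, hs, one_pow, one_mul]
      rw [this, this]
  rw [h2, ← Units.val_pow_eq_pow_val, ← Units.smul_def, ← Units.smul_def] at h1
  exact (smul_left_cancel _ h1).symm

/-! ### The graded determinant and the determinant over the ground field -/

/-- Left multiplication by a matrix, as a linear map over the ground field. -/
def leftMulLin (K : Type*) [Field K] {A : Type*} [Ring A] [Algebra K A] {n : ℕ}
    (X : Matrix (Fin n) (Fin n) A) : (Fin n → A) →ₗ[K] (Fin n → A) where
  toFun := X.mulVec
  map_add' := X.mulVec_add
  map_smul' r v := X.mulVec_smul r v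

variable {𝒜 ν} in
-- If vⱼ has degree y, the output has degree w = x − νᵢ + νⱼ + y. The total factor in the (i, j)
-- term then splits into a part depending on i and w and the part ς(νⱼ, y), because νⱼ + y = w + νᵢ
-- − x.
theorem J_mulVec {x : Γ} {X : Matrix (Fin n) (Fin n) A} (hX : IsHomogeneousMatrix 𝒜 ν x X)
    (v : Fin n → A) (i : Fin n) :
    (J 𝒜 s ν X).mulVec (fun j => toTwisted 𝒜 s (v j)) i =
      toTwisted 𝒜 s (diagScale 𝒜 (fun i w => s.toFun x (w + ν i - x) * s.toFun (ν i) (-w))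
        (leftMulLin K X (diagScale 𝒜 (fun j z => s.toFun (ν j) z) v)) i) := by
  rw [diagScale_apply]
  simp only [leftMulLin, LinearMap.coe_mk, AddHom.coe_mk, Matrix.mulVec, dotProduct, map_sum,
    diagScale_apply]
  refine Finset.sum_congr rfl fun j _ => ?_
  rw [J_of_isHomogeneousMatrix 𝒜 s ν hX, smul_mul_assoc, toTwisted_mul_toTwisted, ← map_smul]
  congr 1
  induction v j using DirectSum.Decomposition.inductionOn 𝒜 with
  | zero => simp [twistMul_zero_right]
  | add a b ha hb => simp only [twistMul_add_right, map_add, smul_add, mul_add, ha, hb]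
  | @homogeneous y a =>
    rw [twistMul_of_mem 𝒜 s (hX i j) a.2, gradedScale_of_mem 𝒜 _ a.2, mul_smul_comm, map_smul,
      gradedScale_of_mem 𝒜 _ (SetLike.GradedMul.mul_mem (hX i j) a.2), smul_smul, smul_smul]
    congr 1
    simp only [s.map_add_left, s.map_add_right, s.map_sub_left, s.map_sub_right, s.map_neg_right,
      Units.val_mul, Units.val_inv_eq_inv_val]
    field_simp

variable {𝒜 ν} in
/-- Up to a sign, the norm of the graded determinant is the determinant over the ground field, if
the values of the NS-multiplier are signs. -/
theorem norm_Gdet_sq {x : Γ} {X : Matrix (Fin n) (Fin n) A} (hX : IsHomogeneousMatrix 𝒜 ν x X)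
    (hs : ∀ x y, s.toFun x y * s.toFun x y = 1) :
    Algebra.norm K (toTwisted 𝒜 s (Gdet 𝒜 s ν X)) ^ 2 = LinearMap.det (leftMulLin K X) ^ 2 := by
  let E : (Fin n → A) ≃ₗ[K] (Fin n → Twisted 𝒜 s) :=
    LinearEquiv.piCongrRight fun _ => toTwisted 𝒜 s
  let a : Fin n → Γ → K := fun i w => s.toFun x (w + ν i - x) * s.toFun (ν i) (-w)
  let b : Fin n → Γ → K := fun j z => s.toFun (ν j) z
  have hs' : ∀ x y, (s.toFun x y : K) * s.toFun x y = 1 := fun x y => by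
    rw [← Units.val_mul, hs, Units.val_one]
  have ha := det_diagScale_mul_self 𝒜 (c := a) fun i w => by
    simp only [a]
    rw [mul_mul_mul_comm, hs', hs', one_mul]
  have hb := det_diagScale_mul_self 𝒜 (c := b) fun j z => hs' _ _
  have h : (Matrix.toLin' (J 𝒜 s ν X)).restrictScalars K = (E : _ →ₗ[K] _) ∘ₗ
      (diagScale 𝒜 a ∘ₗ leftMulLin K X ∘ₗ diagScale 𝒜 b) ∘ₗ (E.symm : _ →ₗ[K] _) :=
    LinearMap.ext fun v => funext fun i => J_mulVec s hX (E.symm v) i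
  have h' := congrArg LinearMap.det h
  -- The determinant of J(X) over K is the norm of its determinant over the commutative twisted
  -- algebra; conjugation by `E` drops out.
  rw [LinearMap.det_restrictScalars, LinearMap.det_toLin', LinearMap.det_conj, LinearMap.det_comp,
    LinearMap.det_comp] at h'
  rw [Gdet, LinearEquiv.apply_symm_apply, h']
  linear_combination (LinearMap.det (diagScale 𝒜 b) ^ 2 * LinearMap.det (leftMulLin K X) ^ 2) * ha +
    LinearMap.det (leftMulLin K X) ^ 2 * hb

end Twisted
/-! ### The Dieudonné determinant -/

/-- The determinant over `ℝ` of the left multiplication by an invertible quaternionic matrix. -/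
noncomputable def realDet (n : ℕ) : GL (Fin n) (Quaternion ℝ) →* ℝˣ :=
  Units.map
    { toFun X := LinearMap.det (leftMulLin ℝ X)
      map_one' := by
        rw [← LinearMap.det_id (A := ℝ) (M := Fin n → Quaternion ℝ)]
        congr 1
        exact LinearMap.ext fun v => Matrix.one_mulVec v
      map_mul' X Y := by
        rw [← LinearMap.det_comp]
        congr 1
        exact LinearMap.ext fun v => (Matrix.mulVec_mulVec v X Y).symm }

/-- The fourth root of the absolute value. -/
noncomputable def fourthRoot : ℝˣ →* ℝˣ where
  toFun a := Units.mk0 √√|(a : ℝ)| (by simp)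
  map_one' := by ext; simp
  map_mul' a b := by
    ext
    simp [abs_mul, Real.sqrt_mul (abs_nonneg _), Real.sqrt_mul (Real.sqrt_nonneg _)]

theorem coe_fourthRoot (a : ℝˣ) : (fourthRoot a : ℝ) = √√|(a : ℝ)| := rfl

/-- The hypothesis is squared because the determinants compared later are known only up to sign. -/
theorem coe_fourthRoot_of_sq_eq {a : ℝˣ} {b : ℝ} (hb : 0 ≤ b) (h : (a : ℝ) ^ 2 = (b ^ 4) ^ 2) :
    (fourthRoot a : ℝ) = b := by
  rw [coe_fourthRoot, (sq_eq_sq_iff_abs_eq_abs _ _).1 h, abs_of_nonneg (by positivity),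
    show b ^ 4 = (b ^ 2) ^ 2 by ring, Real.sqrt_sq (by positivity), Real.sqrt_sq hb]

/-- The Dieudonné determinant: the class of the fourth root of the determinant over `ℝ`. -/
noncomputable def dieudonneDet (n : ℕ) : GL (Fin n) (Quaternion ℝ) →* ℝˣ ⧸ signs :=
  (QuotientGroup.mk' signs).comp (fourthRoot.comp (realDet n))

/-- Over ℝ the matrix is block diagonal with one block a·id on the four-dimensional ℍ; this exponent
4 is why the fourth root is taken. -/
theorem realDet_dilation {n : ℕ} (i : Fin n) (a : ℝˣ) :
    (realDet n (dilation i (realUnits a)) : ℝ) = (a : ℝ) ^ 4 := by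
  have h : leftMulLin ℝ (dilation i (realUnits a) : Matrix (Fin n) (Fin n) (Quaternion ℝ)) =
      LinearMap.pi fun j => ((Function.update 1 i (a : ℝ) : Fin n → ℝ) j •
        (LinearMap.id : Quaternion ℝ →ₗ[ℝ] Quaternion ℝ)) ∘ₗ LinearMap.proj j := by
    refine LinearMap.ext fun v => funext fun j => ?_
    rw [coe_dilation]
    refine (Matrix.mulVec_diagonal _ v j).trans ?_
    rcases eq_or_ne j i with rfl | hj
    · simp [Algebra.smul_def]
    · simp [hj]
  change LinearMap.det (leftMulLin ℝ (dilation i (realUnits a)).val) = _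
  rw [h, LinearMap.det_pi, Finset.prod_eq_single i]
  · rw [LinearMap.det_smul, LinearMap.det_id, Quaternion.finrank_eq_four, Function.update_self,
      mul_one]
  · intro j _ hj
    rw [LinearMap.det_smul, LinearMap.det_id, Function.update_of_ne hj, Pi.one_apply, one_pow,
      one_mul]
  · simp

theorem mk_eq_mk_of_abs_eq {a b : ℝˣ} (h : |(a : ℝ)| = |(b : ℝ)|) :
    (a : ℝˣ ⧸ signs) = (b : ℝˣ ⧸ signs) := by
  rcases abs_eq_abs.1 h with h | h
  · rw [Units.ext h]
  · obtain rfl : a = -b := Units.ext h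
    exact QuotientGroup.eq.2 (Or.inr (by simp))

theorem isDieudonneDet_dieudonneDet (n : ℕ) : IsDieudonneDet (dieudonneDet n) := by
  intro i _ a
  rw [diagUnit_eq_dilation]
  refine mk_eq_mk_of_abs_eq (a := fourthRoot (realDet n _)) ?_
  rw [coe_fourthRoot_of_sq_eq (abs_nonneg (a : ℝ)), abs_abs]
  rw [realDet_dilation, Even.pow_abs (by decide)]

/-! ### The comparison -/

/-- The square has degree 2x = 0, hence is real; its absolute value follows from multiplicativity of
the norm. -/
theorem exists_mul_self_eq_of_mem {x : QuatDeg} {q : Quaternion ℝ} (hq : q ∈ quatGrading x) :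
    ∃ r : ℝ, |r| = ‖q‖ ^ 2 ∧ q * q = algebraMap ℝ (Quaternion ℝ) r := by
  have hr : ∃ r : ℝ, q * q = algebraMap ℝ (Quaternion ℝ) r := by
    obtain ⟨x, hx⟩ := x
    obtain ⟨h1, h2, h3, h4⟩ := hq
    refine ⟨(q * q).re, ?_⟩
    rcases hx with rfl | rfl | rfl | rfl <;> simp (decide := true) at h1 h2 h3 h4 <;>
      ext <;> simp [*]
  obtain ⟨r, hr⟩ := hr
  refine ⟨r, ?_, hr⟩
  rw [pow_two, ← norm_mul, hr, norm_algebraMap', Real.norm_eq_abs]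

theorem quatDeg_add_self (x : QuatDeg) : x + x = 0 := by
  revert x
  decide

/-- Γ has exponent 2, so biadditivity makes every value of ς a sign. -/
theorem NSMultiplier.quat_mul_self (s : NSMultiplier quatLam) (x y : QuatDeg) :
    s.toFun x y * s.toFun x y = 1 := by
  rw [← s.map_add_left, quatDeg_add_self, s.zero_left]

/-- The twisted square q ⋆ q is the scalar ς(x,x) r with |r| = ‖q‖², and the norm of a scalar is its
fourth power. -/
theorem norm_toTwisted_sq (s : NSMultiplier quatLam) {x : QuatDeg} {q : Quaternion ℝ}
    (hq : q ∈ quatGrading x) :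
    Algebra.norm ℝ (toTwisted quatGrading s q) ^ 2 = (‖q‖ ^ 4) ^ 2 := by
  obtain ⟨r, hr, hqr⟩ := exists_mul_self_eq_of_mem hq
  have hs : (s.toFun x x : ℝ) ^ 2 = 1 := by
    rw [pow_two, ← Units.val_mul, s.quat_mul_self, Units.val_one]
  have hmul : toTwisted quatGrading s q * toTwisted quatGrading s q =
      algebraMap ℝ (Twisted quatGrading s) (s.toFun x x * r) := by
    rw [toTwisted_mul_toTwisted, twistMul_of_mem _ s hq hq, hqr, Algebra.algebraMap_eq_smul_one,
      Algebra.algebraMap_eq_smul_one, smul_smul, map_smul, toTwisted_one]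
  have hrank : Module.finrank ℝ (Twisted quatGrading s) = 4 := by
    rw [← (toTwisted quatGrading s).finrank_eq, Quaternion.finrank_eq_four]
  rw [pow_two, ← map_mul, hmul, Algebra.norm_algebraMap, hrank, mul_pow,
    show (s.toFun x x : ℝ) ^ 4 = ((s.toFun x x : ℝ) ^ 2) ^ 2 by ring, hs, one_pow, one_mul,
    ← Even.pow_abs (by decide : Even 4) r, hr]
  ring

theorem quotMap_realIncl (a : ℝˣ) : quotMap (realIncl a) = (a : ℝˣ ⧸ signs) :=
  quotEquiv.symm_apply_apply (a : ℝˣ ⧸ signs)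

/-- u² is a real number of absolute value ‖u‖², on which the quotient map is explicit; injectivity
of squaring gives u itself. -/
theorem quotMap_eq_mk_normUnit (u : HomQuat) : quotMap u = (normUnit u.1 : ℝˣ ⧸ signs) := by
  obtain ⟨x, hx⟩ := u.2
  obtain ⟨r, hr, hur⟩ := exists_mul_self_eq_of_mem hx
  have hr0 : r ≠ 0 := by
    rw [← abs_pos, hr]
    have := norm_pos_iff.2 u.1.ne_zero
    positivity
  have hu : u * u = realIncl (Units.mk0 r hr0) := Subtype.ext (Units.ext hur)
  refine eq_of_mul_self_eq_mul_self ?_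
  rw [← map_mul, hu, quotMap_realIncl, ← QuotientGroup.mk_mul]
  refine mk_eq_mk_of_abs_eq ?_
  rw [Units.val_mk0, hr, Units.val_mul, normUnit, Units.val_mk0, abs_mul, abs_norm, pow_two]

section Comparison

variable {n : ℕ} (s : NSMultiplier quatLam) (ν : Fin n → QuatDeg)

theorem Gdet_mul_of_mem_homGL (X Y : homGL quatGrading ν) :
    Gdet quatGrading s ν ((X * Y).1 : Matrix (Fin n) (Fin n) (Quaternion ℝ)) =
      Gdet quatGrading s ν X.1.val * Gdet quatGrading s ν Y.1.val := by
  obtain ⟨x, hX⟩ := X.2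
  obtain ⟨y, hY⟩ := Y.2
  exact Gdet_mul s hX hY (s.quat_mul_self x y)

/-- The graded determinant of homogeneous invertible quaternionic matrices, as a morphism. -/
noncomputable def gdetHom : homGL quatGrading ν →* HomQuat where
  -- The inverse of Gdet X is Gdet of X⁻¹, by multiplicativity; homogeneity comes from the degree n
  -- • x.
  toFun X := ⟨⟨Gdet quatGrading s ν X.1.val, Gdet quatGrading s ν (X⁻¹).1.val,
      by rw [← Gdet_mul_of_mem_homGL, mul_inv_cancel]; exact Gdet_one quatGrading s ν,
      by rw [← Gdet_mul_of_mem_homGL, inv_mul_cancel]; exact Gdet_one quatGrading s ν⟩,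
    X.2.imp' (n • ·) fun _ hX => Gdet_mem s hX⟩
  map_one' := Subtype.ext (Units.ext (Gdet_one quatGrading s ν))
  map_mul' X Y := Subtype.ext (Units.ext (Gdet_mul_of_mem_homGL s ν X Y))

theorem coe_gdetHom (X : homGL quatGrading ν) :
    ((gdetHom s ν X).1 : Quaternion ℝ) = Gdet quatGrading s ν X.1.val := rfl

/-- Both sides are classes of nonnegative reals: ‖Gdet X‖ and the fourth root of |det_ℝ X|. They
agree since the norm of Gdet X in the twisted algebra equals both ‖Gdet X‖⁴ and det_ℝ X up to sign.
-/
theorem quotMap_gdetHom (X : homGL quatGrading ν) :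
    quotMap (gdetHom s ν X) = dieudonneDet n X.1 := by
  obtain ⟨x, hX⟩ := X.2
  rw [quotMap_eq_mk_normUnit]
  refine mk_eq_mk_of_abs_eq (b := fourthRoot (realDet n X.1)) ?_
  rw [coe_fourthRoot_of_sq_eq (norm_nonneg (Gdet quatGrading s ν X.1.val))]
  · rfl
  · rw [← norm_toTwisted_sq s (Gdet_mem s hX), norm_Gdet_sq s hX s.quat_mul_self]
    rfl

end Comparison

end GradedDet

theorem mainTheorem8 (n : ℕ) :
    (∃! D : GL (Fin n) (Quaternion ℝ) →* ℝˣ ⧸ GradedDet.signs, GradedDet.IsDieudonneDet D) ∧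
    ∀ D : GL (Fin n) (Quaternion ℝ) →* ℝˣ ⧸ GradedDet.signs, GradedDet.IsDieudonneDet D →
      ∀ (s : GradedDet.NSMultiplier GradedDet.quatLam) (ν : Fin n → GradedDet.QuatDeg),
        ∃ G : GradedDet.homGL GradedDet.quatGrading ν →* GradedDet.HomQuat,
          (∀ X : GradedDet.homGL GradedDet.quatGrading ν,
            ((G X).1 : Quaternion ℝ) =
              GradedDet.Gdet GradedDet.quatGrading s ν (X.1 : Matrix (Fin n) (Fin n) (Quaternion ℝ))) ∧
          GradedDet.quotMap.comp G = D.comp (GradedDet.homGL GradedDet.quatGrading ν).subtype := by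
  have h0 := GradedDet.isDieudonneDet_dieudonneDet n
  refine ⟨⟨_, h0, fun D hD => hD.unique h0⟩, fun D hD s ν => ?_⟩
  rw [hD.unique h0]
  exact ⟨GradedDet.gdetHom s ν, GradedDet.coe_gdetHom s ν,
    MonoidHom.ext (GradedDet.quotMap_gdetHom s ν)⟩
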